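/- For an integer $q\ge 2$, a residue class $a$ modulo $q$ and an integer $n\ge 1$, let $\Omega(n;q,a)$ be the number of prime factors of $n$, counted with multiplicity, that are congruent to $a$ modulo $q$. Put $\lambda(n;q,a)=(-1)^{\Omega(n;q,a)}$ and, for residue classes $a_1,\dots,a_r$ modulo $q$, put $\lambda(n;q,a_1,\dots,a_r)=\prod_{i=1}^r\lambda(n;q,a_i)$. Let $q\ge 2$ and let $a_1,\dots,a_{\varphi(q)}$ be the distinct residue classes modulo $q$ with $(a_i,q)=1$. Then the estimate $$\sum_{n\le x}\lambda(n;q,a_1,\dots,a_{\varphi(q)})=o(x)\qquad(x\to\infty)$$ is equivalent to the prime number theorem, that is, to the statement that the number $\pi(x)$ of primes $p\le x$ satisfies $\pi(x)\sim x/\log x$ as $x\to\infty$. -/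

import Mathlib

open Filter Asymptotics

/-- `Ω(n; q, a)`: the number of prime factors of `n`, counted with multiplicity, that are congruent
to `a` modulo `q`. -/
def Omega (q : ℕ) (a : ZMod q) (n : ℕ) : ℕ :=
  n.primeFactorsList.countP (fun p => (p : ZMod q) = a)

/-- `λ(n; q, a) = (-1) ^ Ω(n; q, a)`. -/
def liouvilleAP (q : ℕ) (a : ZMod q) (n : ℕ) : ℤ :=
  (-1) ^ Omega q a n

/-- `λ(n; q, a₁, …, aᵣ) = ∏ᵢ λ(n; q, aᵢ)`. -/
def liouvilleAPs (q : ℕ) {r : ℕ} (a : Fin r → ZMod q) (n : ℕ) : ℤ :=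
  ∏ i, liouvilleAP q (a i) n

/-- `L(x; q, a₁, …, aᵣ) = ∑_{1 ≤ n ≤ x} λ(n; q, a₁, …, aᵣ)`, for real `x`. -/
noncomputable def liouvilleSum (q : ℕ) {r : ℕ} (a : Fin r → ZMod q) (x : ℝ) : ℝ :=
  ∑ n ∈ Finset.Icc 1 ⌊x⌋₊, (liouvilleAPs q a n : ℝ)

/-- The prime number theorem: `π(x) ~ x / log x` as the real variable `x` tends to infinity. -/
def PrimeNumberTheorem : Prop :=
  (fun x : ℝ => (Nat.primeCounting ⌊x⌋₊ : ℝ)) ~[atTop] (fun x : ℝ => x / Real.log x)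

/-! The product over all reduced classes is the completely multiplicative function equal to `1` at
the primes dividing `q` and `-1` at all others. Flipping the sign at one prime `p` preserves mean
value zero, since the two summatory functions are linked by a contracting recursion `N ↦ N / p`
(`sublinear_sum_of_eq_off_multiples`). Finitely many flips lead to the Liouville function `λ`.

There remains the classical equivalence of `∑ λ(n) = o(N)` with `θ(N) ~ N`. From `θ` to `λ`: `λ log
= λ * (λΛ)`, and `λΛ` has partial sums `-N + o(N)`. From `λ` to `θ`: put `P = Λ - 1 + 2γδ`, with `δ`
the convolution identity. Dirichlet's divisor estimate gives `1 * P` partial sums `O(√N)`, so `λ * 1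
* P` has mean value zero (`sublinear_sum_mul`). As `λ * 1` is the indicator of the squares, this
bounds `∑ A(N / d²)`, where `A` sums `P`; the term `d = 1` can be isolated because `∑_{d ≥ 2} 1/d² <
1` (`sublinear_of_sublinear_sum_div_sq`). Both inversions use `Sublinear.of_contraction`. -/

/-- `A(N) = o(N)`, in a form that is uniform in `N`. -/
def Sublinear (A : ℕ → ℝ) : Prop :=
  ∀ ε > 0, ∃ C : ℝ, ∀ N : ℕ, |A N| ≤ ε * N + C

/-! ### Calculus of sublinear sequences -/

namespace Sublinear

theorem add {A B : ℕ → ℝ} (hA : Sublinear A) (hB : Sublinear B) :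
    Sublinear (fun N => A N + B N) := by
  intro ε hε
  obtain ⟨C, hC⟩ := hA (ε / 2) (half_pos hε)
  obtain ⟨D, hD⟩ := hB (ε / 2) (half_pos hε)
  refine ⟨C + D, fun N => ?_⟩
  linarith [abs_add_le (A N) (B N), hC N, hD N]

theorem of_abs_le {A B : ℕ → ℝ} (hB : Sublinear B) (h : ∀ N, |A N| ≤ |B N|) : Sublinear A := by
  intro ε hε
  obtain ⟨C, hC⟩ := hB ε hε
  exact ⟨C, fun N => (h N).trans (hC N)⟩

theorem neg {A : ℕ → ℝ} (hA : Sublinear A) : Sublinear (fun N => -A N) :=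
  hA.of_abs_le fun N => by rw [abs_neg]

theorem sub {A B : ℕ → ℝ} (hA : Sublinear A) (hB : Sublinear B) :
    Sublinear (fun N => A N - B N) := by
  simpa only [sub_eq_add_neg] using hA.add hB.neg

theorem const (c : ℝ) : Sublinear (fun _ => c) := fun ε hε =>
  ⟨|c|, fun N => by
    have : 0 ≤ ε * N := by positivity
    linarith⟩

theorem const_mul {A : ℕ → ℝ} (hA : Sublinear A) (c : ℝ) : Sublinear (fun N => c * A N) := by
  intro ε hε
  obtain ⟨C, hC⟩ := hA (ε / (|c| + 1)) (by positivity)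
  refine ⟨|c| * C, fun N => ?_⟩
  rw [abs_mul]
  have h1 : |c| * (ε / (|c| + 1)) ≤ ε := by
    rw [← mul_div_assoc, div_le_iff₀ (by positivity)]
    nlinarith [abs_nonneg c]
  calc |c| * |A N| ≤ |c| * (ε / (|c| + 1) * N + C) := by gcongr; exact hC N
    _ = |c| * (ε / (|c| + 1)) * N + |c| * C := by ring
    _ ≤ ε * N + |c| * C := by gcongr

theorem sum {ι : Type*} (s : Finset ι) {A : ι → ℕ → ℝ} (hA : ∀ i ∈ s, Sublinear (A i)) :
    Sublinear (fun N => ∑ i ∈ s, A i N) := by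
  classical
  induction s using Finset.induction_on with
  | empty => simpa using const 0
  | insert i s hi ih =>
    simp only [Finset.sum_insert hi]
    exact (hA i (Finset.mem_insert_self i s)).add
      (ih fun j hj => hA j (Finset.mem_insert_of_mem hj))

theorem comp_div {A : ℕ → ℝ} (hA : Sublinear A) (d : ℕ) : Sublinear (fun N => A (N / d)) := by
  intro ε hε
  obtain ⟨C, hC⟩ := hA ε hε
  refine ⟨C, fun N => (hC _).trans ?_⟩
  gcongr
  exact Nat.div_le_self N d

theorem of_le_sqrt {A : ℕ → ℝ} {K : ℝ} (h : ∀ N : ℕ, |A N| ≤ K * √N) :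
    Sublinear A := by
  intro ε hε
  refine ⟨K ^ 2 / ε, fun N => (h N).trans ?_⟩
  have h1 : √(N : ℝ) ^ 2 = N := Real.sq_sqrt (Nat.cast_nonneg N)
  -- Completing the square in `√N`.
  have h2 : ε * √(N : ℝ) ^ 2 + K ^ 2 / ε - K * √N
      = ((ε * √N - K / 2) ^ 2 + 3 / 4 * K ^ 2) / ε := by
    field_simp
    ring
  have h3 : 0 ≤ ((ε * √N - K / 2) ^ 2 + 3 / 4 * K ^ 2) / ε := by positivity
  rw [← h2, h1] at h3
  linarith

/-- A linearly bounded function that obeys a contracting self-estimate is sublinear. -/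
theorem of_contraction {A : ℕ → ℝ} {θ : ℝ} (hθ0 : 0 ≤ θ) (hθ1 : θ < 1)
    (hA : ∃ K C : ℝ, 0 ≤ K ∧ ∀ N : ℕ, |A N| ≤ K * N + C)
    (h : ∀ K C : ℝ, 0 ≤ K → (∀ N : ℕ, |A N| ≤ K * N + C) →
      ∀ ε > 0, ∃ C', ∀ N : ℕ, |A N| ≤ (K * θ + ε) * N + C') : Sublinear A := by
  obtain ⟨K, C, hK, hC⟩ := hA
  have key (ε : ℝ) (hε : 0 < ε) (n : ℕ) : ∃ C', ∀ N : ℕ, |A N| ≤ (ε + K * θ ^ n) * N + C' := by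
    induction n with
    | zero =>
      refine ⟨C, fun N => (hC N).trans ?_⟩
      have : 0 ≤ ε * N := by positivity
      linarith
    | succ n ih =>
      obtain ⟨C', hC'⟩ := ih
      -- The error `ε (1 - θ)` makes `ε` a fixed point of the slope map `k ↦ kθ + ε (1 - θ)`.
      obtain ⟨C'', hC''⟩ := h _ C' (by positivity) hC' (ε * (1 - θ))
        (mul_pos hε (sub_pos.2 hθ1))
      refine ⟨C'', fun N => (hC'' N).trans (le_of_eq ?_)⟩
      ring
  intro ε hε
  have hlim : Tendsto (fun n : ℕ => K * θ ^ n) atTop (nhds 0) := by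
    simpa using (tendsto_pow_atTop_nhds_zero_of_lt_one hθ0 hθ1).const_mul K
  obtain ⟨n, hn⟩ := (hlim.eventually (gt_mem_nhds (half_pos hε))).exists
  obtain ⟨C', hC'⟩ := key (ε / 2) (half_pos hε) n
  refine ⟨C', fun N => (hC' N).trans ?_⟩
  gcongr
  linarith

end Sublinear

theorem isLittleO_floor_iff_sublinear {F : ℝ → ℝ} {A : ℕ → ℝ} (hF : ∀ x, F x = A ⌊x⌋₊) :
    (F =o[atTop] fun x : ℝ => x) ↔ Sublinear A := by
  constructor
  · intro h ε hε
    obtain ⟨X, hX⟩ := eventually_atTop.1 (h.def hε)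
    -- The constant absorbs the finitely many `N` below the threshold.
    refine ⟨∑ n ∈ Finset.range ⌈X⌉₊, |A n|, fun N => ?_⟩
    have h0 : 0 ≤ ∑ n ∈ Finset.range ⌈X⌉₊, |A n| := Finset.sum_nonneg fun _ _ => abs_nonneg _
    by_cases hN : N < ⌈X⌉₊
    · have := Finset.single_le_sum (f := fun n => |A n|) (fun _ _ => abs_nonneg _)
        (Finset.mem_range.2 hN)
      have h1 : 0 ≤ ε * N := by positivity
      linarith
    · have := hX N (Nat.ceil_le.1 (not_lt.1 hN))
      rw [hF, Nat.floor_natCast, Real.norm_eq_abs, Real.norm_eq_abs, Nat.abs_cast] at this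
      linarith
  · intro h
    refine isLittleO_iff.2 fun ε hε => ?_
    obtain ⟨C, hC⟩ := h (ε / 2) (half_pos hε)
    filter_upwards [eventually_ge_atTop (2 * C / ε), eventually_ge_atTop 0] with x hx hx0
    rw [hF, Real.norm_eq_abs, Real.norm_eq_abs, abs_of_nonneg hx0]
    rw [div_le_iff₀ hε] at hx
    have := mul_le_mul_of_nonneg_left (Nat.floor_le hx0) (half_pos hε).le
    linarith [hC ⌊x⌋₊]

/-! ### Changing signs at finitely many primes -/

/-- Partial sums over the multiples of `p`. -/
theorem sum_Ioc_filter_dvd (g : ℕ → ℝ) {p : ℕ} (hp : 0 < p) (N : ℕ) :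
    ∑ n ∈ Finset.Ioc 0 N with p ∣ n, g n = ∑ m ∈ Finset.Ioc 0 (N / p), g (p * m) := by
  symm
  refine Finset.sum_bij (fun m _ => p * m) ?_ ?_ ?_ ?_
  · intro m hm
    rw [Finset.mem_Ioc, Nat.le_div_iff_mul_le hp] at hm
    simp only [Finset.mem_filter, Finset.mem_Ioc, dvd_mul_right, and_true]
    exact ⟨Nat.mul_pos hp hm.1, by linarith [hm.2, mul_comm p m]⟩
  · intro m _ m' _ h
    exact Nat.eq_of_mul_eq_mul_left hp h
  · intro n hn
    simp only [Finset.mem_filter, Finset.mem_Ioc] at hn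
    obtain ⟨⟨h1, h2⟩, m, rfl⟩ := hn
    refine ⟨m, ?_, rfl⟩
    rw [Finset.mem_Ioc, Nat.le_div_iff_mul_le hp]
    exact ⟨Nat.pos_of_mul_pos_left h1, by linarith [mul_comm p m]⟩
  · intro m _
    rfl

/-- Splitting off the multiples of `p` gives `G'(N) = -ε G'(N/p) + (G(N) - ε G(N/p))` for the
partial sums. The bracket is sublinear, and `N/p ≤ N/2` makes this a contraction for `G'`. -/
theorem sublinear_sum_of_eq_off_multiples {g g' : ℕ → ℝ} {p : ℕ} (hp : 2 ≤ p) {ε : ℝ}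
    (hε : |ε| = 1) (hg' : ∀ n, |g' n| ≤ 1) (heq : ∀ n, n ≠ 0 → ¬ p ∣ n → g n = g' n)
    (hgp : ∀ n, n ≠ 0 → g (p * n) = ε * g n) (hgp' : ∀ n, n ≠ 0 → g' (p * n) = -ε * g' n)
    (h : Sublinear fun N => ∑ n ∈ Finset.Ioc 0 N, g n) :
    Sublinear fun N => ∑ n ∈ Finset.Ioc 0 N, g' n := by
  have split (u : ℕ → ℝ) (δ : ℝ) (hu : ∀ n, n ≠ 0 → u (p * n) = δ * u n) (N : ℕ) :
      ∑ n ∈ Finset.Ioc 0 N, u n = δ * ∑ n ∈ Finset.Ioc 0 (N / p), u n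
        + ∑ n ∈ Finset.Ioc 0 N with ¬ p ∣ n, u n := by
    rw [← Finset.sum_filter_add_sum_filter_not (Finset.Ioc 0 N) (fun n => p ∣ n) u,
      sum_Ioc_filter_dvd u (by lia), Finset.mul_sum]
    congr 1
    exact Finset.sum_congr rfl fun n hn => hu n (by simp at hn; lia)
  have key (N : ℕ) : ∑ n ∈ Finset.Ioc 0 N, g' n = -ε * ∑ n ∈ Finset.Ioc 0 (N / p), g' n
      + (∑ n ∈ Finset.Ioc 0 N, g n - ε * ∑ n ∈ Finset.Ioc 0 (N / p), g n) := by
    rw [split g' (-ε) hgp' N, split g ε hgp N]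
    have : ∑ n ∈ Finset.Ioc 0 N with ¬ p ∣ n, g' n = ∑ n ∈ Finset.Ioc 0 N with ¬ p ∣ n, g n :=
      Finset.sum_congr rfl fun n hn => by
        simp only [Finset.mem_filter, Finset.mem_Ioc] at hn
        exact (heq n (by lia) hn.2).symm
    rw [this]
    ring
  have hB := h.sub ((h.comp_div p).const_mul ε)
  refine Sublinear.of_contraction (θ := 1 / 2) (by norm_num) (by norm_num)
    ⟨1, 0, zero_le_one, fun N => ?_⟩ fun K C hK hC η hη => ?_
  · calc |∑ n ∈ Finset.Ioc 0 N, g' n| ≤ ∑ n ∈ Finset.Ioc 0 N, |g' n| :=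
        Finset.abs_sum_le_sum_abs _ _
      _ ≤ ∑ n ∈ Finset.Ioc 0 N, (1 : ℝ) := Finset.sum_le_sum fun n _ => hg' n
      _ = 1 * N + 0 := by simp
  · obtain ⟨D, hD⟩ := hB η hη
    refine ⟨C + D, fun N => ?_⟩
    rw [key]
    refine (abs_add_le _ _).trans ?_
    rw [abs_mul, abs_neg, hε, one_mul]
    have h1 : ((N / p : ℕ) : ℝ) ≤ 1 / 2 * N := by
      calc ((N / p : ℕ) : ℝ) ≤ ((N / 2 : ℕ) : ℝ) := by
            exact_mod_cast Nat.div_le_div_left hp (by norm_num)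
        _ ≤ N / 2 := by exact_mod_cast Nat.cast_div_le (α := ℝ)
        _ = 1 / 2 * N := by ring
    have h2 := mul_le_mul_of_nonneg_left h1 hK
    linarith [hC (N / p), hD N]

/-- The completely multiplicative function with value `1` at the primes in `S` and `-1` at all
other primes. -/
def liouvilleOff (S : Finset ℕ) (n : ℕ) : ℝ :=
  (-1) ^ n.primeFactorsList.countP (fun p => p ∉ S)

theorem abs_liouvilleOff (S : Finset ℕ) (n : ℕ) : |liouvilleOff S n| = 1 := by
  simp [liouvilleOff]

theorem liouvilleOff_prime_mul (S : Finset ℕ) {p n : ℕ} (hp : p.Prime) (hn : n ≠ 0) :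
    liouvilleOff S (p * n) = (if p ∈ S then 1 else -1) * liouvilleOff S n := by
  rw [liouvilleOff, (Nat.perm_primeFactorsList_mul hp.ne_zero hn).countP_eq,
    Nat.primeFactorsList_prime hp, List.singleton_append, List.countP_cons]
  split_ifs with h <;> simp_all [liouvilleOff, pow_succ]

theorem liouvilleOff_insert_of_not_dvd (S : Finset ℕ) {p n : ℕ} (hpn : ¬ p ∣ n) :
    liouvilleOff (insert p S) n = liouvilleOff S n := by
  rw [liouvilleOff, liouvilleOff]
  congr 1
  refine List.countP_congr fun r hr => ?_
  have : r ≠ p := fun h => hpn (h ▸ Nat.dvd_of_mem_primeFactorsList hr)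
  simp [this]

theorem sublinear_liouvilleOff_insert_iff (S : Finset ℕ) {p : ℕ} (hp : p.Prime) (hpS : p ∉ S) :
    Sublinear (fun N => ∑ n ∈ Finset.Ioc 0 N, liouvilleOff (insert p S) n) ↔
      Sublinear (fun N => ∑ n ∈ Finset.Ioc 0 N, liouvilleOff S n) := by
  constructor
  · refine sublinear_sum_of_eq_off_multiples hp.two_le (ε := 1) (by simp)
      (fun n => (abs_liouvilleOff _ n).le) (fun n _ h => liouvilleOff_insert_of_not_dvd S h)
      (fun n hn => ?_) (fun n hn => ?_)
    · rw [liouvilleOff_prime_mul _ hp hn, if_pos (Finset.mem_insert_self p S)]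
    · rw [liouvilleOff_prime_mul _ hp hn, if_neg hpS]
  · refine sublinear_sum_of_eq_off_multiples hp.two_le (ε := -1) (by simp)
      (fun n => (abs_liouvilleOff _ n).le)
      (fun n _ h => (liouvilleOff_insert_of_not_dvd S h).symm)
      (fun n hn => ?_) (fun n hn => ?_)
    · rw [liouvilleOff_prime_mul _ hp hn, if_neg hpS]
    · rw [liouvilleOff_prime_mul _ hp hn, if_pos (Finset.mem_insert_self p S), neg_neg]

theorem sublinear_liouvilleOff_iff (S : Finset ℕ) (hS : ∀ p ∈ S, p.Prime) :
    Sublinear (fun N => ∑ n ∈ Finset.Ioc 0 N, liouvilleOff S n) ↔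
      Sublinear (fun N => ∑ n ∈ Finset.Ioc 0 N, (ArithmeticFunction.liouville n : ℝ)) := by
  induction S using Finset.induction_on with
  | empty =>
    refine iff_of_eq (congrArg Sublinear (funext fun N => Finset.sum_congr rfl fun n hn => ?_))
    rw [ArithmeticFunction.liouville_apply (Finset.mem_Ioc.1 hn).1.ne',
      ArithmeticFunction.cardFactors_apply]
    simp [liouvilleOff]
  | insert p S hp ih =>
    rw [sublinear_liouvilleOff_insert_iff S (hS p (Finset.mem_insert_self p S)) hp,
      ih fun r hr => hS r (Finset.mem_insert_of_mem hr)]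

theorem ZMod.coprime_val_natCast_iff {q : ℕ} (hq : q ≠ 0) (n : ℕ) :
    Nat.Coprime (n : ZMod q).val q ↔ Nat.Coprime n q := by
  have : NeZero q := ⟨hq⟩
  rw [ZMod.val_natCast, Nat.coprime_comm, Nat.Coprime, Nat.gcd_comm, ← Nat.gcd_rec]
  exact Nat.coprime_comm

/-- In `Omega` the predicate is elaborated on `ZMod q`, so the list of primes is coerced entrywise;
here the count returns to natural numbers. -/
theorem Omega_eq_countP (q : ℕ) (a : ZMod q) (n : ℕ) :
    Omega q a n = n.primeFactorsList.countP (fun p : ℕ => (p : ZMod q) = a) := by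
  simp [Omega, ← List.map_eq_flatMap, List.countP_map, Function.comp_def]

/-- A prime not dividing `q` lies in exactly one of the classes `a i`, a prime dividing `q` in none,
so the exponents of `-1` agree. -/
theorem liouvilleAPs_eq_liouvilleOff {q : ℕ} (hq : q ≠ 0) {r : ℕ} (a : Fin r → ZMod q)
    (ha : Set.BijOn a Set.univ {c : ZMod q | Nat.Coprime c.val q}) (n : ℕ) :
    (liouvilleAPs q a n : ℝ) = liouvilleOff q.primeFactors n := by
  have key (l : List ℕ) (hl : ∀ p ∈ l, p.Prime) :
      ∑ i, l.countP (fun p : ℕ => (p : ZMod q) = a i) = l.countP (fun p => p ∉ q.primeFactors) := by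
    induction l with
    | nil => simp
    | cons p l ih =>
      have hp : p.Prime := hl p List.mem_cons_self
      have hcop : p ∉ q.primeFactors ↔ Nat.Coprime (p : ZMod q).val q := by
        rw [ZMod.coprime_val_natCast_iff hq, hp.coprime_iff_not_dvd, Nat.mem_primeFactors]
        simp [hp, hq]
      simp only [List.countP_cons, Finset.sum_add_distrib,
        ih fun r hr => hl r (List.mem_cons_of_mem p hr), decide_eq_true_eq]
      congr 1
      by_cases h : p ∈ q.primeFactors
      · rw [if_neg (not_not_intro h)]
        refine Finset.sum_eq_zero fun i _ => if_neg fun hi => hcop.2 ?_ h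
        rw [hi]
        exact ha.mapsTo (Set.mem_univ i)
      · rw [if_pos h]
        obtain ⟨i, -, hi⟩ := ha.surjOn (hcop.1 h)
        rw [Finset.sum_eq_single i]
        · simp [hi]
        · intro j _ hj
          rw [if_neg]
          intro hpj
          exact hj (ha.injOn (Set.mem_univ j) (Set.mem_univ i) (by rw [← hpj, hi]))
        · simp
  simp only [liouvilleAPs, liouvilleAP, Omega_eq_countP, liouvilleOff, Finset.prod_pow_eq_pow_sum]
  rw [key _ fun p hp => Nat.prime_of_mem_primeFactorsList hp]
  simp

theorem liouvilleSum_isLittleO_iff {q : ℕ} (hq : q ≠ 0) {r : ℕ} (a : Fin r → ZMod q)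
    (ha : Set.BijOn a Set.univ {c : ZMod q | Nat.Coprime c.val q}) :
    (liouvilleSum q a =o[atTop] fun x : ℝ => x) ↔
      Sublinear (fun N => ∑ n ∈ Finset.Ioc 0 N, (ArithmeticFunction.liouville n : ℝ)) := by
  rw [← sublinear_liouvilleOff_iff q.primeFactors fun p hp => Nat.prime_of_mem_primeFactors hp]
  refine isLittleO_floor_iff_sublinear fun x => Finset.sum_congr rfl fun n _ => ?_
  exact liouvilleAPs_eq_liouvilleOff hq a ha n

/-! ### From `π` to `θ` and `ψ` -/

theorem primeNumberTheorem_iff_sublinear_theta :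
    PrimeNumberTheorem ↔ Sublinear (fun N => Chebyshev.theta N - N) := by
  have hθ : ((fun x : ℝ => Chebyshev.theta x - x) =o[atTop] fun x : ℝ => x) ↔
      Sublinear (fun N => Chebyshev.theta N - N) := by
    rw [← isLittleO_floor_iff_sublinear (F := fun x : ℝ => Chebyshev.theta x - ⌊x⌋₊)
      fun x => by rw [Chebyshev.theta_eq_theta_coe_floor]]
    have hfl : (fun x : ℝ => x - ⌊x⌋₊) =o[atTop] fun x : ℝ => x := by
      refine IsBigO.trans_isLittleO (g := fun _ => (1 : ℝ)) ?_ (isLittleO_const_id_atTop 1)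
      refine IsBigO.of_bound 1 ?_
      filter_upwards [eventually_ge_atTop 0] with x hx
      rw [Real.norm_eq_abs, abs_of_nonneg (sub_nonneg.2 (Nat.floor_le hx))]
      simpa using by linarith [Nat.lt_floor_add_one x]
    constructor
    · intro h
      exact (h.add hfl).congr_left fun x => by ring
    · intro h
      exact (h.sub hfl).congr_left fun x => by ring
  rw [← hθ]
  -- Partial summation: `π(x) - θ(x) / log x` is an integral of size `o(x / log x)`.
  have hint := Chebyshev.integral_theta_div_log_sq_isLittleO
  have hpi : (fun x : ℝ => (Nat.primeCounting ⌊x⌋₊ : ℝ) - Chebyshev.theta x / Real.log x)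
      =o[atTop] fun x => x / Real.log x := by
    refine hint.congr' ?_ EventuallyEq.rfl
    filter_upwards [eventually_ge_atTop 2] with x hx
    rw [Chebyshev.primeCounting_eq_theta_div_log_add_integral hx]
    ring
  have hdiv : ((fun x : ℝ => Chebyshev.theta x - x) =o[atTop] fun x : ℝ => x) ↔
      (fun x : ℝ => Chebyshev.theta x / Real.log x - x / Real.log x) =o[atTop]
        fun x => x / Real.log x := by
    have hlog := isBigO_refl (fun x : ℝ => Real.log x) atTop
    have hlog' := isBigO_refl (fun x : ℝ => (Real.log x)⁻¹) atTop
    constructor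
    · intro h
      refine (h.mul_isBigO hlog').congr (fun x => ?_) (fun x => ?_) <;> ring
    · intro h
      refine (h.mul_isBigO hlog).congr' ?_ ?_ <;>
      · filter_upwards [eventually_gt_atTop 1] with x hx
        have := (Real.log_pos hx).ne'
        field_simp
  rw [hdiv, PrimeNumberTheorem, IsEquivalent]
  constructor
  · intro h
    exact (h.sub hpi).congr_left fun x => by simp only [Pi.sub_apply]; ring
  · intro h
    exact (h.add hpi).congr_left fun x => by simp only [Pi.sub_apply]; ring

theorem sublinear_psi_sub_theta :
    Sublinear (fun N => Chebyshev.psi N - Chebyshev.theta N) := by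
  obtain ⟨C, hC⟩ := Chebyshev.psi_sub_theta_le_mul_sqrt
  refine Sublinear.of_le_sqrt (K := |C|) fun N => ?_
  rw [abs_of_nonneg (sub_nonneg.2 (Chebyshev.theta_le_psi N))]
  exact (hC N).trans (by gcongr; exact le_abs_self C)

/-! ### The identity `λ * 1 = 1_□` and elementary sums -/

section
open ArithmeticFunction Finset
open scoped ArithmeticFunction.zeta

/-- The indicator function of the positive squares. -/
def squareIndicator : ArithmeticFunction ℤ where
  toFun n := if n ≠ 0 ∧ IsSquare n then 1 else 0
  map_zero' := by simp

theorem squareIndicator_apply (n : ℕ) :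
    squareIndicator n = if n ≠ 0 ∧ IsSquare n then 1 else 0 := rfl

theorem Nat.Coprime.isSquare_mul_iff {m n : ℕ} (h : m.Coprime n) :
    IsSquare (m * n) ↔ IsSquare m ∧ IsSquare n := by
  refine ⟨fun ⟨c, hc⟩ => ?_, fun ⟨hm, hn⟩ => hm.mul hn⟩
  rw [← sq] at hc
  constructor
  · obtain ⟨d, hd⟩ := exists_eq_pow_of_mul_eq_pow (Nat.isUnit_iff.2 h) hc
    exact ⟨d, by rw [hd, sq]⟩
  · obtain ⟨d, hd⟩ := exists_eq_pow_of_mul_eq_pow (Nat.isUnit_iff.2 h.symm)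
      ((mul_comm n m).trans hc)
    exact ⟨d, by rw [hd, sq]⟩

theorem isMultiplicative_squareIndicator : squareIndicator.IsMultiplicative := by
  rw [IsMultiplicative.iff_ne_zero]
  refine ⟨by simp [squareIndicator_apply], fun {m n} hm hn h => ?_⟩
  simp only [squareIndicator_apply, h.isSquare_mul_iff]
  by_cases h1 : IsSquare m <;> by_cases h2 : IsSquare n <;> simp [h1, h2, hm, hn]

theorem Nat.Prime.isSquare_pow_iff {p : ℕ} (hp : p.Prime) (k : ℕ) :
    IsSquare (p ^ k) ↔ Even k := by
  refine ⟨fun ⟨c, hc⟩ => ?_, fun h => h.isSquare_pow p⟩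
  obtain ⟨j, -, rfl⟩ := (Nat.dvd_prime_pow hp).1 ⟨c, hc⟩
  rw [← pow_add] at hc
  exact ⟨j, Nat.pow_right_injective hp.two_le hc⟩

/-- At `p ^ k` the left side is an alternating sum of `k + 1` signs: `1` for even `k`, `0` for odd
`k`. -/
theorem liouville_mul_zeta : liouville * ζ = squareIndicator := by
  rw [(isMultiplicative_liouville.mul isMultiplicative_zeta.natCast).eq_iff_eq_on_prime_powers _ _
    isMultiplicative_squareIndicator]
  intro p k hp
  rw [coe_mul_zeta_apply, Nat.sum_divisors_prime_pow hp, squareIndicator_apply,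
    sum_congr rfl fun i _ => by
      rw [liouville_apply (pow_ne_zero i hp.ne_zero), cardFactors_apply_prime_pow hp]]
  simp only [hp.isSquare_pow_iff, neg_one_geom_sum, ne_eq, pow_eq_zero_iff', hp.ne_zero, false_and,
    not_false_eq_true, true_and, Nat.even_add_one]
  split_ifs <;> simp_all

theorem sum_squareIndicator_mul (G : ℕ → ℝ) (N : ℕ) :
    ∑ n ∈ Ioc 0 N, (squareIndicator n : ℝ) * G n = ∑ d ∈ Ioc 0 N.sqrt, G (d ^ 2) := by
  simp only [squareIndicator_apply, Int.cast_ite, Int.cast_one, Int.cast_zero, ite_mul, one_mul,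
    zero_mul]
  rw [← sum_filter]
  symm
  refine sum_bij (fun d _ => d ^ 2) ?_ ?_ ?_ ?_
  · intro d hd
    rw [mem_Ioc, Nat.le_sqrt'] at hd
    rw [mem_filter, mem_Ioc]
    have := hd.1
    exact ⟨⟨by positivity, hd.2⟩, by positivity, IsSquare.sq d⟩
  · intro d _ e _ h
    exact Nat.pow_left_injective two_ne_zero h
  · intro n hn
    rw [mem_filter, mem_Ioc] at hn
    obtain ⟨⟨h0, hN⟩, -, d, rfl⟩ := hn
    refine ⟨d, ?_, sq d⟩
    rw [mem_Ioc, Nat.le_sqrt]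
    exact ⟨Nat.pos_of_mul_pos_left h0, hN⟩
  · intro d _
    rfl

/-- The Liouville function with real values. -/
noncomputable abbrev liouvilleReal : ArithmeticFunction ℝ := (liouville : ArithmeticFunction ℝ)

theorem abs_liouvilleReal_le (n : ℕ) : |liouvilleReal n| ≤ 1 := by
  rw [intCoe_apply]
  by_cases hn : n = 0
  · simp [hn]
  · simp [liouville_apply hn]

theorem liouvilleReal_mul_zeta :
    liouvilleReal * (ζ : ArithmeticFunction ℝ) = (squareIndicator : ArithmeticFunction ℝ) := by
  rw [← liouville_mul_zeta, intCoe_mul]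
  congr 1

theorem sum_liouville_mul_div (N : ℕ) :
    ∑ n ∈ Ioc 0 N, liouvilleReal n * ((N / n : ℕ) : ℝ) = N.sqrt := by
  rw [← sum_Ioc_mul_zeta_eq_sum, liouvilleReal_mul_zeta]
  simpa using sum_squareIndicator_mul (fun _ => 1) N

theorem sum_inv_sqrt_le (N : ℕ) : ∑ n ∈ Ioc 0 N, (√(n : ℝ))⁻¹ ≤ 2 * √N := by
  induction N with
  | zero => simp
  | succ N ih =>
    rw [sum_Ioc_succ_top (Nat.zero_le N)]
    have h1 : 0 < √((N + 1 : ℕ) : ℝ) := by positivity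
    have h2 : √((N + 1 : ℕ) : ℝ) ^ 2 = N + 1 := by
      rw [Real.sq_sqrt (by positivity)]
      push_cast
      rfl
    have h3 : √(N : ℝ) ^ 2 = N := Real.sq_sqrt (by positivity)
    -- After multiplication by `√(N+1)` the two sides differ by exactly `(√(N+1) - √N)²`.
    suffices (√((N + 1 : ℕ) : ℝ))⁻¹ ≤ 2 * √((N + 1 : ℕ) : ℝ) - 2 * √N by linarith
    rw [inv_le_iff_one_le_mul₀ h1]
    nlinarith [sq_nonneg (√((N + 1 : ℕ) : ℝ) - √N)]

theorem mul_log_sub_le_log_factorial (N : ℕ) : N * Real.log N - N ≤ Real.log N.factorial := by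
  rcases eq_or_ne N 0 with rfl | hN
  · simp
  have h1 := Stirling.le_log_factorial_stirling hN
  have h2 : 0 ≤ Real.log N := Real.log_natCast_nonneg N
  have h3 : 0 ≤ Real.log (2 * Real.pi) := Real.log_nonneg (by linarith [Real.pi_gt_three])
  linarith

theorem log_factorial_le {N : ℕ} (hN : N ≠ 0) :
    Real.log N.factorial ≤ N * Real.log N - N + 1 + Real.log N := by
  induction N, Nat.one_le_iff_ne_zero.2 hN using Nat.le_induction with
  | base => simp
  | succ n hn ih =>
    have hn0 : (0 : ℝ) < n := by exact_mod_cast hn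
    rw [Nat.factorial_succ, Nat.cast_mul, Real.log_mul (by positivity) (by positivity)]
    have h1 := Real.one_sub_inv_le_log_of_pos (x := ((n + 1 : ℕ) : ℝ) / n) (by positivity)
    rw [Real.log_div (by positivity) hn0.ne', inv_div] at h1
    have h2 : 1 ≤ ((n + 1 : ℕ) : ℝ) * (Real.log (n + 1 : ℕ) - Real.log n) := by
      refine le_trans (le_of_eq ?_) (mul_le_mul_of_nonneg_left h1 (by positivity))
      push_cast
      field_simp
      ring
    have := ih (by lia)
    push_cast at h2 ⊢
    linarith

theorem log_factorial_eq_sum (N : ℕ) :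
    Real.log N.factorial = ∑ n ∈ Ioc 0 N, Real.log n := by
  induction N with
  | zero => simp
  | succ N ih =>
    rw [sum_Ioc_succ_top (Nat.zero_le N), Nat.factorial_succ, Nat.cast_mul,
      Real.log_mul (by positivity) (by positivity), ih, add_comm]

/-! ### From `θ` to `λ` -/

/-- `∑ λ(n) = o(N)` follows from the prime number theorem. -/
theorem sublinear_sum_liouville_of_sublinear_theta
    (hθ : Sublinear fun N => Chebyshev.theta N - N) :
    Sublinear fun N => ∑ n ∈ Ioc 0 N, (liouville n : ℝ) := by
  set T : ℕ → ℝ := fun N => ∑ n ∈ Ioc 0 N, (pmul liouvilleReal Λ) n with hT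
  have hTs : Sublinear fun N => T N + N := by
    -- Since `λ(p) = -1`, the primes cancel against `θ`; the higher prime powers contribute at most
    -- `ψ - θ`.
    have h1 : Sublinear fun N => T N + Chebyshev.theta N := by
      refine sublinear_psi_sub_theta.of_abs_le fun N => ?_
      rw [abs_of_nonneg (sub_nonneg.2 (Chebyshev.theta_le_psi N)),
        Chebyshev.psi_sub_theta_eq_sum_not_prime, hT, Chebyshev.theta, Nat.floor_natCast]
      have : ∑ n ∈ Ioc 0 N, (pmul liouvilleReal Λ) n + ∑ p ∈ Ioc 0 N with p.Prime, Real.log p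
          = ∑ n ∈ Ioc 0 N with ¬ n.Prime, (pmul liouvilleReal Λ) n := by
        rw [← sum_filter_add_sum_filter_not (Ioc 0 N) (fun n => n.Prime)
          (pmul liouvilleReal Λ), add_right_comm, ← sum_add_distrib, add_eq_right]
        refine sum_eq_zero fun p hp => ?_
        have hp := (mem_filter.1 hp).2
        rw [pmul_apply, intCoe_apply, vonMangoldt_apply_prime hp, liouville_apply hp.ne_zero,
          cardFactors_apply_prime hp]
        simp
      simp only [this]
      refine (abs_sum_le_sum_abs _ _).trans (sum_le_sum fun n _ => ?_)
      rw [pmul_apply, abs_mul, abs_of_nonneg (vonMangoldt_nonneg (n := n))]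
      exact mul_le_of_le_one_left vonMangoldt_nonneg (abs_liouvilleReal_le n)
    exact (h1.sub hθ).of_abs_le fun N => le_of_eq (by ring_nf)
  -- Twist `log = 1 * Λ` by the completely multiplicative `λ`.
  have hconv : pmul liouvilleReal log = liouvilleReal * pmul liouvilleReal Λ := by
    ext n
    rw [pmul_apply, ← zeta_mul_vonMangoldt, mul_apply, mul_apply, mul_sum]
    refine sum_congr rfl fun x hx => ?_
    obtain ⟨hx1, hx2⟩ := Nat.mem_divisorsAntidiagonal.1 hx
    rw [← hx1] at hx2
    rw [← hx1, intCoe_apply, liouville_apply_mul, pmul_apply, intCoe_apply, intCoe_apply,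
      natCoe_apply, zeta_apply_ne (left_ne_zero_of_mul hx2)]
    push_cast
    ring
  intro ε hε
  obtain ⟨C, hC⟩ := hTs (ε / 2) (half_pos hε)
  have hC0 : 0 ≤ C := by simpa using (abs_nonneg _).trans (hC 0)
  have hmain (N : ℕ) : |∑ n ∈ Ioc 0 N, liouvilleReal n| * Real.log N
      ≤ ε / 2 * N * Real.log N + (ε / 2 + C + 2) * N := by
    -- Adding `⌊N/n⌋` to `T(N/n)` removes its main term; the total correction `∑ λ(n) ⌊N/n⌋` is only
    -- `⌊√N⌋`.
    have e1 : ∑ n ∈ Ioc 0 N, liouvilleReal n * Real.log n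
        = ∑ n ∈ Ioc 0 N, liouvilleReal n * (T (N / n) + (N / n : ℕ)) - N.sqrt := by
      have := sum_Ioc_mul_eq_sum_sum liouvilleReal (pmul liouvilleReal Λ) N
      rw [← hconv] at this
      simp only [pmul_apply (f := liouvilleReal) (g := log), log_apply] at this
      rw [this, ← sum_liouville_mul_div, ← sum_sub_distrib]
      exact sum_congr rfl fun n _ => by rw [hT]; ring
    have e2 : |∑ n ∈ Ioc 0 N, liouvilleReal n * (T (N / n) + (N / n : ℕ))|
        ≤ ε / 2 * N * (1 + Real.log N) + C * N := by
      calc _ ≤ ∑ n ∈ Ioc 0 N, |liouvilleReal n * (T (N / n) + (N / n : ℕ))| :=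
            abs_sum_le_sum_abs _ _
        _ ≤ ∑ n ∈ Ioc 0 N, (ε / 2 * N * (n : ℝ)⁻¹ + C) := by
            refine sum_le_sum fun n _ => ?_
            rw [abs_mul]
            refine (mul_le_of_le_one_left (abs_nonneg _) (abs_liouvilleReal_le n)).trans ?_
            refine (hC _).trans ?_
            rw [mul_assoc, ← div_eq_mul_inv]
            gcongr
            exact Nat.cast_div_le
        _ = ε / 2 * N * harmonic N + C * N := by
            rw [sum_add_distrib, ← mul_sum, harmonic_eq_sum_Icc]
            push_cast
            simp only [sum_const, Nat.card_Ioc, tsub_zero, nsmul_eq_mul, mul_comm C]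
            rfl
        _ ≤ _ := by gcongr; exact harmonic_le_one_add_log N
    -- Replacing `log n` by `log N` costs at most `N log N - log N! ≤ N`.
    have e3 : |∑ n ∈ Ioc 0 N, liouvilleReal n * (Real.log N - Real.log n)| ≤ N := by
      calc _ ≤ ∑ n ∈ Ioc 0 N, |liouvilleReal n * (Real.log N - Real.log n)| :=
            abs_sum_le_sum_abs _ _
        _ ≤ ∑ n ∈ Ioc 0 N, (Real.log N - Real.log n) := by
            refine sum_le_sum fun n hn => ?_
            rw [mem_Ioc] at hn
            have hle : Real.log n ≤ Real.log N :=
              Real.log_le_log (by exact_mod_cast hn.1) (by exact_mod_cast hn.2)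
            rw [abs_mul, abs_of_nonneg (sub_nonneg.2 hle)]
            exact mul_le_of_le_one_left (sub_nonneg.2 hle) (abs_liouvilleReal_le n)
        _ = N * Real.log N - Real.log N.factorial := by
            rw [sum_sub_distrib, log_factorial_eq_sum]
            simp
        _ ≤ N := by linarith [mul_log_sub_le_log_factorial N]
    have e4 : (∑ n ∈ Ioc 0 N, liouvilleReal n) * Real.log N
        = ∑ n ∈ Ioc 0 N, liouvilleReal n * (Real.log N - Real.log n)
          + ∑ n ∈ Ioc 0 N, liouvilleReal n * Real.log n := by
      rw [sum_mul, ← sum_add_distrib]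
      exact sum_congr rfl fun n _ => by ring
    have e5 : (N.sqrt : ℝ) ≤ N := by exact_mod_cast Nat.sqrt_le_self N
    have e6 : (0 : ℝ) ≤ N.sqrt := Nat.cast_nonneg _
    rw [← abs_of_nonneg (Real.log_natCast_nonneg N), ← abs_mul,
      abs_of_nonneg (Real.log_natCast_nonneg N), e4, e1]
    rw [abs_le] at e2 e3 ⊢
    constructor <;> linarith
  set D := ε / 2 + C + 2
  have hD : 0 < D := by positivity
  -- Beyond `N₀` one has `D ≤ (ε/2) log N`; below it the trivial bound `N` suffices.
  obtain ⟨N₀, hN₀⟩ := (eventually_atTop.1 ((Real.tendsto_log_atTop.comp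
    tendsto_natCast_atTop_atTop).eventually_ge_atTop (2 * D / ε + 1)))
  refine ⟨N₀, fun N => ?_⟩
  have hεN : 0 ≤ ε * N := by positivity
  rcases le_or_gt N₀ N with hN | hN
  · have hl : 2 * D / ε + 1 ≤ Real.log N := hN₀ N hN
    have hl0 : 0 < Real.log N := lt_of_lt_of_le (by positivity) hl
    have hl1 : D ≤ ε / 2 * Real.log N := by
      have h1 : 2 * D / ε ≤ Real.log N := by linarith
      rw [div_le_iff₀ hε] at h1
      linarith
    have h2 : |∑ n ∈ Ioc 0 N, liouvilleReal n| * Real.log N ≤ ε * N * Real.log N := by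
      have := mul_le_mul_of_nonneg_right hl1 (Nat.cast_nonneg (α := ℝ) N)
      linarith [hmain N]
    have h3 := le_of_mul_le_mul_right h2 hl0
    simp only [intCoe_apply] at h3
    exact h3.trans (le_add_of_nonneg_right (Nat.cast_nonneg _))
  · have h1 : |∑ n ∈ Ioc 0 N, liouvilleReal n| ≤ N :=
      (abs_sum_le_sum_abs _ _).trans ((sum_le_sum fun n _ => abs_liouvilleReal_le n).trans
        (by simp))
    simp only [intCoe_apply] at h1
    have h2 : (N : ℝ) ≤ N₀ := by exact_mod_cast hN.le
    linarith


/-! ### The hyperbola method -/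

/-- The part of an arithmetic function supported on `n ≤ M`. -/
def ArithmeticFunction.truncate (f : ArithmeticFunction ℝ) (M : ℕ) : ArithmeticFunction ℝ where
  toFun n := if n ≤ M then f n else 0
  map_zero' := by simp

theorem arithmeticFunction_sub_apply (f g : ArithmeticFunction ℝ) (n : ℕ) :
    (f - g) n = f n - g n := by
  rw [sub_eq_add_neg, sub_eq_add_neg]
  rfl

theorem truncate_apply (f : ArithmeticFunction ℝ) (M n : ℕ) :
    f.truncate M n = if n ≤ M then f n else 0 := rfl

theorem sum_truncate_mul (f : ArithmeticFunction ℝ) {G : ℕ → ℝ} (M N : ℕ)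
    (hG : ∀ n, N < n → G n = 0) :
    ∑ n ∈ Ioc 0 N, f.truncate M n * G n = ∑ n ∈ Ioc 0 M, f n * G n := by
  have h1 : ∑ n ∈ Ioc 0 N, f.truncate M n * G n
      = ∑ n ∈ Ioc 0 (max M N), f.truncate M n * G n := by
    refine sum_subset (Ioc_subset_Ioc_right (le_max_right M N)) fun n hn hn' => ?_
    rw [mem_Ioc] at hn hn'
    rw [hG n (by lia), mul_zero]
  rw [h1]
  symm
  refine (sum_congr rfl fun n hn => ?_).trans
    (sum_subset (Ioc_subset_Ioc_right (le_max_left M N)) fun n hn hn' => ?_)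
  · rw [truncate_apply, if_pos (mem_Ioc.1 hn).2]
  · rw [mem_Ioc] at hn hn'
    rw [truncate_apply, if_neg (by lia), zero_mul]

theorem sum_truncate (f : ArithmeticFunction ℝ) (M N : ℕ) :
    ∑ n ∈ Ioc 0 N, f.truncate M n = ∑ n ∈ Ioc 0 (min M N), f n := by
  simp only [truncate_apply]
  rw [← sum_filter]
  refine sum_congr ?_ fun _ _ => rfl
  ext n
  simp only [mem_filter, mem_Ioc]
  lia

/-- Dirichlet's hyperbola identity for the divisor function. -/
theorem sum_zeta_mul_zeta (N : ℕ) :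
    ∑ n ∈ Ioc 0 N, ((ζ : ArithmeticFunction ℝ) * (ζ : ArithmeticFunction ℝ)) n
      = 2 * ∑ n ∈ Ioc 0 N.sqrt, ((N / n : ℕ) : ℝ) - (N.sqrt : ℝ) ^ 2 := by
  set s := N.sqrt
  set z : ArithmeticFunction ℝ := (ζ : ArithmeticFunction ℝ) with hz
  have hz1 (n : ℕ) (hn : n ≠ 0) : z n = 1 := by
    rw [hz, natCoe_apply, zeta_apply_ne hn, Nat.cast_one]
  have hzs (K : ℕ) : ∑ n ∈ Ioc 0 K, z n = K := by
    rw [sum_congr rfl fun n hn => hz1 n (mem_Ioc.1 hn).1.ne']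
    simp
  set u := z.truncate s with hu
  -- The last product has no mass up to `N`: two factors exceeding `s` multiply to at least `(s +
  -- 1)² > N`.
  have hdec : z * z = u * z + u * z - u * u + (z - u) * (z - u) := by ring
  have h1 : ∑ n ∈ Ioc 0 N, (u * z) n = ∑ n ∈ Ioc 0 s, ((N / n : ℕ) : ℝ) := by
    rw [sum_Ioc_mul_eq_sum_sum]
    simp only [hzs]
    rw [hu, sum_truncate_mul z s N fun n hn => by rw [Nat.div_eq_of_lt hn, Nat.cast_zero]]
    exact sum_congr rfl fun n hn => by rw [hz1 n (mem_Ioc.1 hn).1.ne', one_mul]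
  have h2 : ∑ n ∈ Ioc 0 N, (u * u) n = (s : ℝ) ^ 2 := by
    rw [sum_Ioc_mul_eq_sum_sum]
    simp only [hu, sum_truncate, hzs]
    rw [sum_truncate_mul z s N fun n hn => by simp [Nat.div_eq_of_lt hn]]
    have (n : ℕ) (hn : n ∈ Ioc 0 s) : z n * ((min s (N / n) : ℕ) : ℝ) = s := by
      rw [mem_Ioc] at hn
      rw [hz1 n hn.1.ne', one_mul, min_eq_left]
      rw [Nat.le_div_iff_mul_le hn.1]
      exact (Nat.mul_le_mul_left s hn.2).trans (Nat.sqrt_le N)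
    rw [sum_congr rfl this]
    simp [sq]
  have h3 : ∑ n ∈ Ioc 0 N, ((z - u) * (z - u)) n = 0 := by
    rw [sum_Ioc_mul_eq_sum_prod_filter]
    refine sum_eq_zero fun x hx => ?_
    have hx := (mem_filter.1 hx).2
    have hv (n : ℕ) (hn : n ≤ s) : (z - u) n = 0 := by
      rw [arithmeticFunction_sub_apply, hu, truncate_apply, if_pos hn, sub_self]
    by_cases h : x.1 ≤ s
    · rw [hv _ h, zero_mul]
    · have : x.2 ≤ s := by
        by_contra h'
        have h4 := Nat.mul_le_mul (not_le.1 h) (not_le.1 h')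
        exact absurd (Nat.lt_succ_sqrt N) (not_lt.2 (h4.trans hx))
      rw [hv _ this, mul_zero]
  rw [hdec]
  simp only [ArithmeticFunction.add_apply, arithmeticFunction_sub_apply, sum_add_distrib, sum_sub_distrib, h1, h2] at h3 ⊢
  rw [h3]
  ring

/-- By `sum_zeta_mul_zeta` the bracket is the divisor sum `N log N + (2γ - 1) N + O(√N)`, while `log
N! = N log N - N + O(log N)`; so `2γN` cancels what remains. The constant `11` is crude. -/
theorem abs_log_factorial_sub_sum_div_le (N : ℕ) :
    |Real.log N.factorial - (2 * ∑ n ∈ Ioc 0 N.sqrt, ((N / n : ℕ) : ℝ) - (N.sqrt : ℝ) ^ 2)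
      + 2 * Real.eulerMascheroniConstant * N| ≤ 11 * √N := by
  rcases eq_or_ne N 0 with rfl | hN
  · simp
  set s := N.sqrt with hs
  set γ := Real.eulerMascheroniConstant
  have hs1 : 1 ≤ s := Nat.sqrt_pos.2 (Nat.pos_of_ne_zero hN)
  have hsN : s ^ 2 ≤ N := Nat.sqrt_le' N
  have hNs : N ≤ s ^ 2 + 2 * s := by
    have := Nat.sqrt_le_add N
    rw [sq]
    lia
  have hN0 : (0 : ℝ) < N := by exact_mod_cast Nat.pos_of_ne_zero hN
  have hs1' : (1 : ℝ) ≤ s := by exact_mod_cast hs1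
  have hs0 : (0 : ℝ) < s := by linarith
  have hsN' : (s : ℝ) ^ 2 ≤ N := by exact_mod_cast hsN
  have hNs' : (N : ℝ) ≤ s ^ 2 + 2 * s := by exact_mod_cast hNs
  have hsq : (s : ℝ) ≤ √N := Real.le_sqrt_of_sq_le hsN'
  have hNds : (N : ℝ) / s ≤ 3 * s := by
    rw [div_le_iff₀ hs0]
    nlinarith
  set h : ℝ := ∑ n ∈ Ioc 0 s, (n : ℝ)⁻¹ with hh
  have hharm : (harmonic s : ℝ) = h := by
    rw [harmonic_eq_sum_Icc]
    push_cast
    rfl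
  have hfl1 : ∑ n ∈ Ioc 0 s, ((N / n : ℕ) : ℝ) ≤ N * h := by
    rw [hh, mul_sum]
    exact sum_le_sum fun n _ => by rw [← div_eq_mul_inv]; exact Nat.cast_div_le
  have hfl2 : N * h - s ≤ ∑ n ∈ Ioc 0 s, ((N / n : ℕ) : ℝ) := by
    have : N * h - s = ∑ n ∈ Ioc 0 s, (N * (n : ℝ)⁻¹ - 1) := by
      rw [hh, mul_sum, sum_sub_distrib]
      simp
    rw [this]
    refine sum_le_sum fun n _ => ?_
    rw [← div_eq_mul_inv, ← Nat.floor_div_eq_div (K := ℝ)]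
    exact (Nat.sub_one_lt_floor _).le
  have hγ1 : Real.log s + γ ≤ h := by
    have := Real.eulerMascheroniConstant_lt_eulerMascheroniSeq' s
    rw [Real.eulerMascheroniSeq', if_neg (by lia), hharm] at this
    linarith
  have hγ2 : h ≤ Real.log s + γ + 1 / s := by
    have h1 := Real.eulerMascheroniSeq_lt_eulerMascheroniConstant s
    rw [Real.eulerMascheroniSeq, hharm] at h1
    have h2 := Real.log_le_sub_one_of_pos (x := ((s : ℝ) + 1) / s) (by positivity)
    rw [Real.log_div (by positivity) hs0.ne', add_div, div_self hs0.ne'] at h2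
    linarith
  have hlog1 : 2 * Real.log s ≤ Real.log N := by
    have := Real.log_le_log (by positivity) hsN'
    rwa [Real.log_pow, Nat.cast_ofNat] at this
  have hlog2 : Real.log N - 2 * Real.log s ≤ 2 / s := by
    have h2 := Real.log_le_sub_one_of_pos (x := (N : ℝ) / s ^ 2) (by positivity)
    rw [Real.log_div hN0.ne' (by positivity), Real.log_pow, Nat.cast_ofNat] at h2
    refine h2.trans ?_
    rw [sub_le_iff_le_add, div_le_iff₀ (by positivity)]
    have : (2 / s + 1) * (s : ℝ) ^ 2 = s ^ 2 + 2 * s := by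
      field_simp
      ring
    linarith
  have hlogN : Real.log N ≤ 2 * s := by
    have h1 := Real.log_le_sub_one_of_pos hs0
    have h2 : 2 / (s : ℝ) ≤ 2 := div_le_self (by norm_num) hs1'
    linarith
  have hm1 := mul_le_mul_of_nonneg_left hγ1 hN0.le
  have hm2 := mul_le_mul_of_nonneg_left hγ2 hN0.le
  have hm3 := mul_le_mul_of_nonneg_left hlog1 hN0.le
  have hm4 := mul_le_mul_of_nonneg_left hlog2 hN0.le
  have e1 : (N : ℝ) * (1 / s) = N / s := by ring
  have e2 : (N : ℝ) * (2 / s) = 2 * (N / s) := by ring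
  have hf1 := mul_log_sub_le_log_factorial N
  have hf2 := log_factorial_le hN
  rw [abs_le]
  constructor <;> linarith

/-- A hyperbola argument: convolution with a function with partial sums `O(√N)` preserves
mean value zero. -/
theorem sublinear_sum_mul {f g : ArithmeticFunction ℝ} (hf : ∀ n, |f n| ≤ 1)
    (hfs : Sublinear fun N => ∑ n ∈ Ioc 0 N, f n) {K : ℝ} (hK : 0 ≤ K)
    (hg : ∀ N : ℕ, |∑ n ∈ Ioc 0 N, g n| ≤ K * √N) :
    Sublinear fun N => ∑ n ∈ Ioc 0 N, (f * g) n := by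
  -- For fixed `M` this is a finite linear combination of partial sums of `f` at `N / n`.
  have hlow (M : ℕ) : Sublinear fun N => ∑ n ∈ Ioc 0 N, (f * g.truncate M) n := by
    have h1 (N : ℕ) : ∑ n ∈ Ioc 0 N, (f * g.truncate M) n
        = ∑ n ∈ Ioc 0 M, g n * ∑ m ∈ Ioc 0 (N / n), f m := by
      rw [mul_comm, sum_Ioc_mul_eq_sum_sum, sum_truncate_mul g M N]
      intro n hn
      simp [Nat.div_eq_of_lt hn]
    simp only [h1]
    exact Sublinear.sum _ fun n _ => (hfs.comp_div n).const_mul (g n)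
  -- The partial sums of the tail vanish up to `M`, so only `n ≤ N / M` matter, and `∑ √(N/n)` over
  -- these is `O(N / √M)`.
  have hhigh (M : ℕ) (hM : 0 < M) (N : ℕ) :
      |∑ n ∈ Ioc 0 N, (f * (g - g.truncate M)) n| ≤ 4 * K / √M * N := by
    have hv (k : ℕ) : ∑ n ∈ Ioc 0 k, (g - g.truncate M) n
        = ∑ n ∈ Ioc 0 k, g n - ∑ n ∈ Ioc 0 (min M k), g n := by
      simp only [arithmeticFunction_sub_apply, sum_sub_distrib, sum_truncate]
    have hv0 (k : ℕ) (hk : k ≤ M) : ∑ n ∈ Ioc 0 k, (g - g.truncate M) n = 0 := by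
      rw [hv, min_eq_right hk, sub_self]
    have hv1 (k : ℕ) : |∑ n ∈ Ioc 0 k, (g - g.truncate M) n| ≤ 2 * K * √k := by
      rw [hv]
      refine (abs_sub _ _).trans ?_
      have h1 : K * √((min M k : ℕ) : ℝ) ≤ K * √k := by
        gcongr
        exact min_le_right M k
      linarith [hg k, hg (min M k)]
    have hM0 : (0 : ℝ) < M := by exact_mod_cast hM
    have hcut : ∑ n ∈ Ioc 0 N, (f * (g - g.truncate M)) n
        = ∑ n ∈ Ioc 0 (N / M), f n * ∑ m ∈ Ioc 0 (N / n), (g - g.truncate M) m := by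
      rw [sum_Ioc_mul_eq_sum_sum]
      symm
      refine sum_subset (Ioc_subset_Ioc_right (Nat.div_le_self N M)) fun n hn hn' => ?_
      rw [mem_Ioc] at hn hn'
      rw [hv0, mul_zero]
      have h1 : N / M < n := by lia
      rw [Nat.div_lt_iff_lt_mul hM] at h1
      exact Nat.div_le_of_le_mul h1.le
    rw [hcut]
    calc _ ≤ ∑ n ∈ Ioc 0 (N / M), |f n * ∑ m ∈ Ioc 0 (N / n), (g - g.truncate M) m| :=
          abs_sum_le_sum_abs _ _
      _ ≤ ∑ n ∈ Ioc 0 (N / M), 2 * K * √N * (√(n : ℝ))⁻¹ := by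
          refine sum_le_sum fun n _ => ?_
          rw [abs_mul]
          refine (mul_le_of_le_one_left (abs_nonneg _) (hf n)).trans ((hv1 _).trans ?_)
          rw [mul_assoc _ (√(N : ℝ)), ← div_eq_mul_inv, ← Real.sqrt_div (Nat.cast_nonneg N)]
          gcongr
          exact Nat.cast_div_le
      _ ≤ 2 * K * √N * (2 * √((N / M : ℕ) : ℝ)) := by
          rw [← mul_sum]
          gcongr
          exact sum_inv_sqrt_le _
      _ ≤ 2 * K * √N * (2 * (√N / √M)) := by
          rw [← Real.sqrt_div (Nat.cast_nonneg N)]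
          gcongr
          exact Nat.cast_div_le
      _ = 4 * K / √M * (√N * √N) := by ring
      _ = 4 * K / √M * N := by rw [Real.mul_self_sqrt (Nat.cast_nonneg N)]
  intro ε hε
  have hlim : Tendsto (fun M : ℕ => 4 * K / √(M : ℝ)) atTop (nhds 0) :=
    tendsto_const_nhds.div_atTop (Real.tendsto_sqrt_atTop.comp tendsto_natCast_atTop_atTop)
  obtain ⟨M, hM, hM0⟩ := ((hlim.eventually (gt_mem_nhds (half_pos hε))).and
    (eventually_gt_atTop 0)).exists
  obtain ⟨C, hC⟩ := hlow M (ε / 2) (half_pos hε)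
  refine ⟨C, fun N => ?_⟩
  have hdec : f * g = f * g.truncate M + f * (g - g.truncate M) := by ring
  rw [hdec]
  simp only [ArithmeticFunction.add_apply, sum_add_distrib]
  refine (abs_add_le _ _).trans ?_
  have h1 := hhigh M hM0 N
  have h2 := mul_le_mul_of_nonneg_right hM.le (Nat.cast_nonneg (α := ℝ) N)
  linarith [hC N]

/-! ### From `λ` back to `θ` -/

theorem sum_Ioc_one_inv_sq_le (s : ℕ) : ∑ d ∈ Ioc 1 s, ((d : ℝ) ^ 2)⁻¹ ≤ 3 / 4 := by
  rcases lt_or_ge s 2 with hs | hs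
  · rw [Ioc_eq_empty (by lia)]
    norm_num
  · rw [← sum_Ioc_consecutive _ one_le_two hs, show Ioc 1 2 = {2} from rfl, sum_singleton]
    have h1 := sum_Ioc_inv_sq_le_sub (α := ℝ) two_ne_zero hs
    have h2 : (0 : ℝ) ≤ (s : ℝ)⁻¹ := by positivity
    norm_num at h1 ⊢
    linarith

/-- With `d = 1` isolated, the terms `d ≥ 2` multiply a linear bound on `A` by at most `∑ 1/d² ≤ 1/4
+ 1/2 = 3/4`, which is a contraction; the additive constants cost only `O(√N)`. -/
theorem sublinear_of_sublinear_sum_div_sq {A : ℕ → ℝ} (hA0 : A 0 = 0) {K : ℝ} (hK : 0 ≤ K)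
    (hA : ∃ C, ∀ N : ℕ, |A N| ≤ K * N + C)
    (h : Sublinear fun N => ∑ d ∈ Ioc 0 N.sqrt, A (N / d ^ 2)) : Sublinear A := by
  obtain ⟨C₀, hC₀⟩ := hA
  refine Sublinear.of_contraction (θ := 3 / 4) (by norm_num) (by norm_num) ⟨K, C₀, hK, hC₀⟩ ?_
  intro K C hK hC ε hε
  have hC0 : 0 ≤ C := by simpa [hA0] using hC 0
  have hsqrt : Sublinear fun N => C * (N.sqrt : ℝ) := by
    refine Sublinear.of_le_sqrt (K := C) fun N => ?_
    rw [abs_of_nonneg (by positivity)]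
    gcongr
    exact Real.nat_sqrt_le_real_sqrt
  obtain ⟨D, hD⟩ := h (ε / 2) (half_pos hε)
  obtain ⟨E, hE⟩ := hsqrt (ε / 2) (half_pos hε)
  refine ⟨D + E, fun N => ?_⟩
  have hDE : 0 ≤ D + E := add_nonneg (by simpa [hA0] using hD 0) (by simpa using hE 0)
  rcases eq_or_ne N 0 with rfl | hN
  · simpa [hA0] using hDE
  have hs1 : 1 ≤ N.sqrt := Nat.sqrt_pos.2 (Nat.pos_of_ne_zero hN)
  have hsplit : A N = ∑ d ∈ Ioc 0 N.sqrt, A (N / d ^ 2) - ∑ d ∈ Ioc 1 N.sqrt, A (N / d ^ 2) := by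
    rw [← sum_Ioc_consecutive _ zero_le_one hs1, add_sub_cancel_right,
      show Ioc 0 1 = {1} from rfl, sum_singleton, one_pow, Nat.div_one]
  have htail : |∑ d ∈ Ioc 1 N.sqrt, A (N / d ^ 2)| ≤ K * N * (3 / 4) + C * N.sqrt := by
    calc _ ≤ ∑ d ∈ Ioc 1 N.sqrt, |A (N / d ^ 2)| := abs_sum_le_sum_abs _ _
      _ ≤ ∑ d ∈ Ioc 1 N.sqrt, (K * N * ((d : ℝ) ^ 2)⁻¹ + C) := by
          refine sum_le_sum fun d _ => (hC _).trans ?_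
          rw [mul_assoc, ← div_eq_mul_inv]
          gcongr
          exact_mod_cast Nat.cast_div_le (α := ℝ) (m := N) (n := d ^ 2)
      _ = K * N * ∑ d ∈ Ioc 1 N.sqrt, ((d : ℝ) ^ 2)⁻¹ + C * ((N.sqrt - 1 : ℕ) : ℝ) := by
          rw [sum_add_distrib, ← mul_sum]
          simp [mul_comm]
      _ ≤ _ := by
          gcongr
          · exact sum_Ioc_one_inv_sq_le _
          · exact Nat.sub_le _ _
  have hE' := (le_abs_self _).trans (hE N)
  rw [hsplit]
  refine (abs_sub _ _).trans ?_
  linarith [hD N]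

/-- The prime number theorem, for `θ`, follows from `∑ λ(n) = o(N)`. -/
theorem sublinear_theta_of_sublinear_sum_liouville
    (hL : Sublinear fun N => ∑ n ∈ Ioc 0 N, (liouville n : ℝ)) :
    Sublinear fun N => Chebyshev.theta N - N := by
  -- The term `2γδ` supplies the `2γN` needed in `1 * P`; it shifts the partial sums of `P` only by
  -- a constant.
  set c : ArithmeticFunction ℝ :=
    ⟨fun n => if n = 1 then 2 * Real.eulerMascheroniConstant else 0, by simp⟩ with hc
  set z : ArithmeticFunction ℝ := (ζ : ArithmeticFunction ℝ) with hz
  set P : ArithmeticFunction ℝ := Λ - z + c with hP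
  have hcs (N : ℕ) (hN : N ≠ 0) :
      ∑ n ∈ Ioc 0 N, c n = 2 * Real.eulerMascheroniConstant := by
    rw [sum_eq_single_of_mem 1 (mem_Ioc.2 ⟨one_pos, Nat.one_le_iff_ne_zero.2 hN⟩)]
    · simp [hc]
    · intro n _ hn
      simp [hc, hn]
  have hzs (N : ℕ) : ∑ n ∈ Ioc 0 N, z n = N := by
    have := sum_Ioc_zeta N
    rw [hz]
    simp only [natCoe_apply]
    exact_mod_cast this
  have hPs (N : ℕ) (hN : N ≠ 0) : ∑ n ∈ Ioc 0 N, P n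
      = Chebyshev.psi N - N + 2 * Real.eulerMascheroniConstant := by
    simp only [hP, ArithmeticFunction.add_apply, arithmeticFunction_sub_apply, sum_add_distrib, sum_sub_distrib, hzs, hcs N hN]
    rw [Chebyshev.psi, Nat.floor_natCast]
  have hG (N : ℕ) : |∑ n ∈ Ioc 0 N, (z * P) n| ≤ 11 * √N := by
    refine le_trans (le_of_eq (congrArg _ ?_)) (abs_log_factorial_sub_sum_div_le N)
    rw [hP, mul_add, mul_sub, hz, zeta_mul_vonMangoldt]
    simp only [ArithmeticFunction.add_apply, arithmeticFunction_sub_apply, sum_add_distrib, sum_sub_distrib, sum_zeta_mul_zeta]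
    rw [log_factorial_eq_sum, sum_Ioc_mul_eq_sum_sum]
    congr 1
    rw [sum_congr rfl fun n hn => by
      rw [hcs (N / n) (Nat.div_pos (mem_Ioc.1 hn).2 (mem_Ioc.1 hn).1).ne'], ← sum_mul, ← hz, hzs,
      mul_comm]
  have hconv := sublinear_sum_mul abs_liouvilleReal_le
    (hL.of_abs_le fun N => by simp only [intCoe_apply]; rfl) (by norm_num) hG
  have hψ : Sublinear fun N => ∑ n ∈ Ioc 0 N, P n := by
    -- Chebyshev's bound on `ψ` gives the a priori linear bound; `2` covers `2γ`.
    refine sublinear_of_sublinear_sum_div_sq (K := Real.log 4 + 5) (by simp)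
      (by positivity) ⟨2, fun N => ?_⟩ ?_
    · rcases eq_or_ne N 0 with rfl | hN
      · simp
      rw [hPs N hN, abs_le]
      have h1 := Chebyshev.psi_le_const_mul_self (Nat.cast_nonneg (α := ℝ) N)
      have h2 := Chebyshev.psi_nonneg N
      have h3 := Real.one_half_lt_eulerMascheroniConstant
      have h4 := Real.eulerMascheroniConstant_lt_two_thirds
      have h5 : 0 ≤ Real.log 4 * N := by positivity
      have h6 : (0 : ℝ) ≤ N := Nat.cast_nonneg N
      constructor <;> linarith
    · refine hconv.of_abs_le fun N => le_of_eq (congrArg _ ?_)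
      rw [← mul_assoc, liouvilleReal_mul_zeta, sum_Ioc_mul_eq_sum_sum]
      exact (sum_squareIndicator_mul (fun n => ∑ m ∈ Ioc 0 (N / n), P m) N).symm
  have hbdd : Sublinear fun N => Chebyshev.psi N - N - ∑ n ∈ Ioc 0 N, P n := by
    refine (Sublinear.const (2 * Real.eulerMascheroniConstant)).of_abs_le fun N => ?_
    rcases eq_or_ne N 0 with rfl | hN
    · simp
    · rw [hPs N hN, sub_add_cancel_left, abs_neg]
  exact ((hbdd.add hψ).sub sublinear_psi_sub_theta).of_abs_le fun N => le_of_eq (by ring_nf)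

end

theorem mainTheorem7 (q : ℕ) (hq : 2 ≤ q) (a : Fin (Nat.totient q) → ZMod q)
    (ha : Set.BijOn a Set.univ {c : ZMod q | Nat.Coprime c.val q}) :
    (liouvilleSum q a =o[atTop] fun x : ℝ => x) ↔ PrimeNumberTheorem := by
  rw [liouvilleSum_isLittleO_iff (by lia) a ha, primeNumberTheorem_iff_sublinear_theta]
  exact ⟨sublinear_theta_of_sublinear_sum_liouville, sublinear_sum_liouville_of_sublinear_theta⟩
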